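/- A directed hypergraph $H$ has a finite vertex set $V$ with $n=|V|$ and a set of directed hyperedges $e$, each with one source vertex $s_e$ and a non-empty set of destination vertices $T_e\subseteq V\setminus\{s_e\}$. For vertices $s\neq t$, a hyperpath from $s$ to $t$ is a sequence of hyperedges $L=(e_1,\dots,e_m)$, $m\ge 1$, with $s_{e_1}=s$, $s_{e_i}\in T_{e_{i-1}}$ for $1<i\le m$, and $t\in T_{e_m}$. Its width is $W(L)=|\{s_{e_1}\}\cup\bigcup_{i}T_{e_i}|$, and its length is $\sum_i|T_{e_i}|$. The thinnest path problem (TP) asks for a hyperpath from $s$ to $t$ of minimum width $W_{\mathrm{opt}}$. The shortest-path-based algorithm (SPBA) returns a hyperpath from $s$ to $t$ of minimum length (whenever there is a hyperpath from $s$ to $t$); it is a $\rho$-approximation on $H$ if for all $s\ne t$ joined by a hyperpath every such returned path $L$ satisfies $W(L)\le\rho\,W_{\mathrm{opt}}$. Let the vertices be distinct points of $d$-dimensional Euclidean space, and let each vertex $v$ have a minimum range $r_v$ and a maximum range $R_v$, $0\le r_v\le R_v$. In the ring hypergraph there is a hyperedge from $v$ to $T$ if and only if $T$ is non-empty and is the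 set of all vertices other than $v$ in the closed ball around $v$ of some radius $x$ with $r_v<x\le R_v$. A disk hypergraph is a ring hypergraph with $r_v=0$ for all $v$. **Theorem.** 1. SPBA is a $\sqrt{n/2}$-approximation for TP on every directed hypergraph with $n$ vertices. 2. SPBA is a $2(1+2\alpha)^d$-approximation for TP on every ring hypergraph in $d$-dimensional Euclidean space, where $$\alpha=\frac{\max_{v\in V}R_v}{\max\{\min_{v\in V}r_v,\ \min_{u\neq v}d(u,v)\}}.$$ The same holds if the condition on the radii is $r_v\le x\le R_v$ instead of $r_v<x\le R_v$. 3. The ratio $\sqrt{n/2}$ is asymptotically tight even for disk hypergraphs in the plane: for every $\varepsilon>0$ and every sufficiently large $n$ there are a disk hypergraph with $n$ vertices in the plane and vertices $s\ne t$, joined by a hyperpath, such that every path $L$ from $s$ to $t$ that SPBA may return satisfies $W(L)\ge(1-\varepsilon)\sqrt{n/2}\;W_{\mathrm{opt}}$. -/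

import Mathlib

/-- A directed hyperedge: a single source vertex and a set of destination vertices. -/
structure DirectedHyperedge (V : Type*) where
  /-- the source vertex of the hyperedge -/
  src : V
  /-- the set of destination vertices of the hyperedge -/
  dest : Finset V

/-- A directed hypergraph on the vertex set `V`: a set of directed hyperedges, each with a
non-empty destination set that does not contain the source of the hyperedge. -/
structure DirectedHypergraph (V : Type*) where
  /-- the set of directed hyperedges -/
  edges : Set (DirectedHyperedge V)
  dest_nonempty : ∀ e ∈ edges, e.dest.Nonempty
  src_notMem_dest : ∀ e ∈ edges, e.src ∉ e.dest

/-- The cover of a sequence of hyperedges: all destination vertices of its hyperedges,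
together with the source vertex of its first hyperedge. -/
def hyperpathCover {V : Type*} (L : List (DirectedHyperedge V)) : Set V :=
  {v | (∃ e ∈ L, v ∈ e.dest) ∨ ∃ e ∈ L.head?, v = e.src}

/-- The width of a sequence of hyperedges: the number of vertices in its cover. -/
noncomputable def hyperpathWidth {V : Type*} (L : List (DirectedHyperedge V)) : ℕ :=
  (hyperpathCover L).ncard

/-- The length of a sequence of hyperedges, where the weight of a hyperedge is the number of
its destination vertices. -/
def hyperpathLength {V : Type*} (L : List (DirectedHyperedge V)) : ℕ :=
  (L.map fun e => e.dest.card).sum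

namespace DirectedHypergraph

/-- `L` is a hyperpath from `s` to `t` in `H`: a non-empty sequence of hyperedges of `H`, the
first one rooted at `s`, each later one rooted at a destination vertex of its predecessor, and
the last one reaching `t`. -/
def IsHyperpath {V : Type*} (H : DirectedHypergraph V) (s t : V)
    (L : List (DirectedHyperedge V)) : Prop :=
  (∀ e ∈ L, e ∈ H.edges) ∧
  L.IsChain (fun e f => f.src ∈ e.dest) ∧
  ∃ hL : L ≠ [], (L.head hL).src = s ∧ t ∈ (L.getLast hL).dest

/-- A thinnest path from `s` to `t`: a hyperpath of minimum width. -/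
def IsThinnestPath {V : Type*} (H : DirectedHypergraph V) (s t : V)
    (L : List (DirectedHyperedge V)) : Prop :=
  H.IsHyperpath s t L ∧ ∀ L', H.IsHyperpath s t L' → hyperpathWidth L ≤ hyperpathWidth L'

/-- A shortest path from `s` to `t`: a hyperpath of minimum length, where a hyperedge has as
weight the number of its destination vertices. These are the possible outputs of the
shortest-path-based algorithm. -/
def IsShortestPath {V : Type*} (H : DirectedHypergraph V) (s t : V)
    (L : List (DirectedHyperedge V)) : Prop :=
  H.IsHyperpath s t L ∧ ∀ L', H.IsHyperpath s t L' → hyperpathLength L ≤ hyperpathLength L'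

/-- The shortest-path-based algorithm is a `ρ`-approximation for the thinnest path problem on
`H`: for every source-destination pair that is joined by some hyperpath, there is a shortest path
to return, and whichever shortest path is returned, its width is at most `ρ` times the width of
a thinnest path. -/
def ShortestPathApprox {V : Type*} (H : DirectedHypergraph V) (ρ : ℝ) : Prop :=
  ∀ s t : V, s ≠ t → (∃ L, H.IsHyperpath s t L) →
    (∃ L, H.IsShortestPath s t L) ∧
    ∀ L Lopt, H.IsShortestPath s t L → H.IsThinnestPath s t Lopt →
      (hyperpathWidth L : ℝ) ≤ ρ * (hyperpathWidth Lopt : ℝ)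

end DirectedHypergraph

/-- The directed hypergraph of a family of points `p` in `d`-dimensional Euclidean space in which
the vertex `v` may transmit with any radius in `I v`: there is a hyperedge from `v` to `T` if and
only if `T` is non-empty and consists exactly of the other vertices in the closed ball around `v`
of some radius in `I v`. -/
def ballHypergraph {V : Type*} {d : ℕ} (p : V → EuclideanSpace ℝ (Fin d)) (I : V → Set ℝ) :
    DirectedHypergraph V where
  edges := {e | e.dest.Nonempty ∧
    ∃ x ∈ I e.src, ∀ v, v ∈ e.dest ↔ v ≠ e.src ∧ dist (p v) (p e.src) ≤ x}
  dest_nonempty := fun _ he => he.1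
  src_notMem_dest := by
    rintro e ⟨-, x, -, hx⟩ h
    exact ((hx _).1 h).1 rfl

/-- The disk hypergraph with maximum ranges `R`: radii in `(0, R v]`. -/
def diskHypergraph {V : Type*} {d : ℕ} (p : V → EuclideanSpace ℝ (Fin d)) (R : V → ℝ) :
    DirectedHypergraph V :=
  ballHypergraph p fun v => Set.Ioc 0 (R v)

/-- The ring hypergraph with minimum ranges `r` and maximum ranges `R`: radii in `(r v, R v]`. -/
def ringHypergraph {V : Type*} {d : ℕ} (p : V → EuclideanSpace ℝ (Fin d)) (r R : V → ℝ) :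
    DirectedHypergraph V :=
  ballHypergraph p fun v => Set.Ioc (r v) (R v)

/-- The variant of the ring hypergraph in which the minimum range is itself an admissible radius:
radii in `[r v, R v]`. With `r = R` this is a disk graph (one fixed radius per vertex). -/
def closedRingHypergraph {V : Type*} {d : ℕ} (p : V → EuclideanSpace ℝ (Fin d)) (r R : V → ℝ) :
    DirectedHypergraph V :=
  ballHypergraph p fun v => Set.Icc (r v) (R v)

/-- The largest maximum range, divided by the larger one of the smallest minimum range and the
smallest distance between two different points. -/
noncomputable def ringRatio {V : Type*} {d : ℕ} (p : V → EuclideanSpace ℝ (Fin d))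
    (r R : V → ℝ) : ℝ :=
  (⨆ v, R v) / max (⨅ v, r v) (Set.range p).infsep

/-! Since every vertex of the cover other than the source is a destination, W ≤ length + 1; it
therefore suffices to turn a thinnest path, of width k, into a path of small length.

General case: cut the path where it first meets its target and recurse on the source of the last
hyperedge. Each recursion removes one vertex, so the destination sets have sizes at most k-1, k-2,
..., and the length is at most k(k-1)/2 (`IsHyperpath.exists_length_le_choose`). As k ≥ 2, this
gives W ≤ k²/2; multiplied by W ≤ n it gives W² ≤ n k²/2.

Ring case: drop hyperedges of the thinnest path until no shortcut is left
(`IsHyperpath.exists_without_shortcuts`). Then sources two or more steps apart are separated by the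
denominator δ of α, so within one parity class of indices a volume packing (`card_le_of_separated`)
bounds by B = (1+2α)^d how often a vertex is covered. Both classes together give length + 1 ≤ 2Bk.

Tightness: on the chain of points 2^i, reaching the next point means covering all earlier ones, so
the chain path has width at most K+3 but length at least C(K+1,2). A detour up a column and down a
descent of M+1 points has length M + O(K). With K close to √(2n) the detour is shorter, and every
path shorter than C(K+1,2) has width at least M = n - O(K), giving a ratio close to n/√(2n) =
√(n/2). -/

/-! ### Length, width and surgery of hyperpaths. -/

theorem hyperpathLength_append {V : Type*} (L L' : List (DirectedHyperedge V)) :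
    hyperpathLength (L ++ L') = hyperpathLength L + hyperpathLength L' := by
  simp [hyperpathLength]

theorem hyperpathLength_singleton {V : Type*} (e : DirectedHyperedge V) :
    hyperpathLength [e] = e.dest.card := by
  simp [hyperpathLength]

/-- The destination vertices of a sequence of hyperedges, counted without multiplicity, are at
most as many as its length. -/
theorem ncard_dest_le_hyperpathLength {V : Type*} (L : List (DirectedHyperedge V)) :
    {v | ∃ e ∈ L, v ∈ e.dest}.Finite ∧
      {v | ∃ e ∈ L, v ∈ e.dest}.ncard ≤ hyperpathLength L := by
  induction L with
  | nil => simp [hyperpathLength]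
  | cons e L ih =>
    have h : {v | ∃ f ∈ e :: L, v ∈ f.dest} = (e.dest : Set V) ∪ {v | ∃ f ∈ L, v ∈ f.dest} := by
      ext v; simp
    refine ⟨h ▸ e.dest.finite_toSet.union ih.1, ?_⟩
    rw [h]
    refine (Set.ncard_union_le _ _).trans ?_
    rw [Set.ncard_coe_finset]
    simpa [hyperpathLength] using ih.2

theorem hyperpathWidth_le_succ_length {V : Type*} (L : List (DirectedHyperedge V)) :
    hyperpathWidth L ≤ hyperpathLength L + 1 := by
  cases L with
  | nil => simp [hyperpathWidth, hyperpathCover]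
  | cons e L =>
    have h : hyperpathCover (e :: L) = {v | ∃ f ∈ e :: L, v ∈ f.dest} ∪ {e.src} := by
      ext v
      simp only [hyperpathCover, List.head?_cons, Option.mem_def, Option.some.injEq,
        exists_eq_left', Set.mem_union, Set.mem_ofPred_eq, Set.mem_singleton_iff]
    rw [hyperpathWidth, h]
    refine (Set.ncard_union_le _ _).trans ?_
    rw [Set.ncard_singleton]
    exact Nat.add_le_add_right (ncard_dest_le_hyperpathLength _).2 1

namespace DirectedHypergraph

variable {V : Type*} {H : DirectedHypergraph V} {s t u : V} {L L' : List (DirectedHyperedge V)}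
  {e : DirectedHyperedge V}

theorem IsHyperpath.ne_nil (h : H.IsHyperpath s t L) : L ≠ [] := h.2.2.1

theorem IsHyperpath.length_pos (h : H.IsHyperpath s t L) : 0 < L.length :=
  List.length_pos_iff.2 h.ne_nil

theorem isHyperpath_singleton (he : e ∈ H.edges) (ht : t ∈ e.dest) :
    H.IsHyperpath e.src t [e] :=
  ⟨by simpa using he, by simp, by simp, by simp, by simpa using ht⟩

theorem IsHyperpath.append (h : H.IsHyperpath s u L) (h' : H.IsHyperpath u t L') :
    H.IsHyperpath s t (L ++ L') := by
  obtain ⟨h1, h2, h3, h4, h5⟩ := h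
  obtain ⟨h1', h2', h3', h4', h5'⟩ := h'
  refine ⟨?_, ?_, by simp [h3], ?_, ?_⟩
  · simp only [List.mem_append]
    rintro e (h | h)
    exacts [h1 e h, h1' e h]
  · rw [List.isChain_append]
    refine ⟨h2, h2', ?_⟩
    intro x hx y hy
    rw [List.getLast?_eq_getLast_of_ne_nil h3] at hx
    rw [List.head?_eq_some_head h3'] at hy
    simp only [Option.mem_def, Option.some.injEq] at hx hy
    rw [← hx, ← hy, h4']
    exact h5
  · rw [List.head_append_of_ne_nil h3]
    exact h4
  · rw [List.getLast_append_of_ne_nil _ h3']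
    exact h5'

theorem IsHyperpath.take (h : H.IsHyperpath s t L) {i : ℕ} (hi : i < L.length)
    (hu : u ∈ L[i].dest) : H.IsHyperpath s u (L.take (i + 1)) := by
  obtain ⟨h1, h2, h3, h4, h5⟩ := h
  refine ⟨fun e he => h1 e (List.mem_of_mem_take he), h2.take _, by simp [h3], ?_, ?_⟩
  · rw [List.head_take]
    exact h4
  · have : (L.take (i + 1)).getLast (by simp [h3]) = L[i] := by
      rw [List.getLast_eq_getElem]
      simp [Nat.min_eq_left (Nat.succ_le_of_lt hi)]
    rw [this]
    exact hu

theorem IsHyperpath.drop (h : H.IsHyperpath s t L) {j : ℕ} (hj : j < L.length) :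
    H.IsHyperpath L[j].src t (L.drop j) := by
  obtain ⟨h1, h2, h3, h4, h5⟩ := h
  have hne : L.drop j ≠ [] := by simpa using hj
  refine ⟨fun e he => h1 e (List.mem_of_mem_drop he), h2.drop _, hne, ?_, ?_⟩
  · rw [List.head_drop]
  · rw [List.getLast_drop]
    exact h5

/-- Decomposition of a hyperpath at its last hyperedge. -/
theorem isHyperpath_concat_iff :
    H.IsHyperpath s t (L ++ [e]) ↔
      e ∈ H.edges ∧ t ∈ e.dest ∧ (L = [] ∧ e.src = s ∨ H.IsHyperpath s e.src L) := by
  constructor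
  · intro h
    refine ⟨h.1 e (by simp), by simpa using h.2.2.2.2, ?_⟩
    rcases eq_or_ne L [] with rfl | hL
    · exact Or.inl ⟨rfl, by simpa using h.2.2.2.1⟩
    · right
      obtain ⟨h1, h2, h3, h4, h5⟩ := h
      rw [List.isChain_append] at h2
      refine ⟨fun f hf => h1 f (by simp [hf]), h2.1, hL, ?_, ?_⟩
      · rwa [List.head_append_of_ne_nil hL] at h4
      · exact h2.2.2 _ (List.getLast?_eq_getLast_of_ne_nil hL) e (by simp)
  · rintro ⟨he, ht, ⟨rfl, rfl⟩ | h⟩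
    · exact isHyperpath_singleton he ht
    · exact h.append (isHyperpath_singleton he ht)

/-- The source of a hyperedge of a hyperpath is the source of the hyperpath or a destination of
a hyperedge of the hyperpath. -/
theorem IsHyperpath.src_eq_or_exists (h : H.IsHyperpath s t L) (he : e ∈ L) :
    e.src = s ∨ ∃ f ∈ L, e.src ∈ f.dest := by
  obtain ⟨L₁, L₂, rfl⟩ := List.append_of_mem he
  have hi : L₁.length < (L₁ ++ e :: L₂).length := by simp
  obtain ⟨x, hx⟩ := H.dest_nonempty e (h.1 e he)
  have h' := h.take hi (u := x) (by simpa using hx)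
  have : (L₁ ++ e :: L₂).take (L₁.length + 1) = L₁ ++ [e] := by
    simp [List.take_append]
  rw [this, isHyperpath_concat_iff] at h'
  rcases h'.2.2 with ⟨-, h'⟩ | h'
  · exact Or.inl h'
  · refine Or.inr ⟨L₁.getLast h'.ne_nil, ?_, h'.2.2.2.2⟩
    simp

/-! ### General directed hypergraphs: the ratio √(n/2). -/

/-- A hyperpath whose vertices lie in a set of `k` vertices can be replaced by one of length at
most `k.choose 2`. -/
theorem IsHyperpath.exists_length_le_choose [DecidableEq V] (h : H.IsHyperpath s t L)
    (hst : s ≠ t) (A : Finset V) (hs : s ∈ A) (hA : ∀ e ∈ L, e.dest ⊆ A) :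
    ∃ L', H.IsHyperpath s t L' ∧ hyperpathLength L' ≤ A.card.choose 2 := by
  induction hn : L.length using Nat.strong_induction_on generalizing L t A with
  | _ n ih =>
    obtain ⟨L₀, e, rfl⟩ : ∃ L₀ e, L = L₀ ++ [e] :=
      ⟨_, _, (List.dropLast_append_getLast h.ne_nil).symm⟩
    -- If `t` is met before the last hyperedge, truncate there. Otherwise the earlier hyperedges
    -- avoid `t`, so the recursion runs in `A.erase t`.
    by_cases hmem : ∃ f ∈ L₀, t ∈ f.dest
    · obtain ⟨f, hf, htf⟩ := hmem
      obtain ⟨i, hi, rfl⟩ := List.getElem_of_mem hf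
      have hi' : i < (L₀ ++ [e]).length := by simp; omega
      have h' := h.take hi' (u := t) (by simpa [List.getElem_append_left hi] using htf)
      refine ih _ ?_ h' hst A hs (fun g hg => hA g (List.mem_of_mem_take hg)) rfl
      rw [← hn]
      simp only [List.length_take, List.length_append, List.length_singleton]
      omega
    · push Not at hmem
      rw [isHyperpath_concat_iff] at h
      obtain ⟨he, ht, h⟩ := h
      have hesub : e.dest ⊆ A := hA e (by simp)
      have htA : t ∈ A := hesub ht
      have hcard : ((A.erase t).card + 1) = A.card := Finset.card_erase_add_one htA
      -- The last hyperedge misses its own source, so it costs at most |A| - 1; this identity pays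
      -- for it and leaves the budget of `A.erase t`.
      have hchoose : A.card.choose 2 = (A.erase t).card + (A.erase t).card.choose 2 := by
        rw [← hcard, Nat.choose_succ_succ' _ 1, Nat.choose_one_right]
      have hdest : e.src ∈ A → e.dest.card ≤ (A.erase t).card := by
        intro hsrc
        have h1 : e.dest ⊆ A.erase e.src := fun x hx =>
          Finset.mem_erase.2 ⟨fun hxe => H.src_notMem_dest e he (hxe ▸ hx), hesub hx⟩
        have h2 := Finset.card_le_card h1
        have h3 := Finset.card_erase_add_one hsrc
        omega
      by_cases hes : e.src = s
      · refine ⟨[e], hes ▸ isHyperpath_singleton he ht, ?_⟩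
        have := hdest (hes ▸ hs)
        rw [hyperpathLength_singleton]
        omega
      · rcases h with ⟨-, h⟩ | h
        · exact absurd h hes
        · have hA' : ∀ f ∈ L₀, f.dest ⊆ A.erase t := fun f hf x hx =>
            Finset.mem_erase.2 ⟨fun hxt => hmem f hf (hxt ▸ hx), hA f (by simp [hf]) hx⟩
          have hsrc : e.src ∈ A.erase t := by
            exact hA' _ (List.getLast_mem h.ne_nil) h.2.2.2.2
          obtain ⟨L', hL', hlen⟩ := ih L₀.length (by rw [← hn]; simp) h (Ne.symm hes)
            (A.erase t) (Finset.mem_erase.2 ⟨hst, hs⟩) hA' rfl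
          refine ⟨L' ++ [e], hL'.append (isHyperpath_singleton he ht), ?_⟩
          rw [hyperpathLength_append, hyperpathLength_singleton]
          have := hdest (Finset.mem_of_mem_erase hsrc)
          omega

theorem IsHyperpath.mem_cover_source (h : H.IsHyperpath s t L) : s ∈ hyperpathCover L := by
  obtain ⟨-, -, h3, h4, -⟩ := h
  exact Or.inr ⟨L.head h3, List.head?_eq_some_head h3, h4.symm⟩

theorem IsHyperpath.mem_cover_target (h : H.IsHyperpath s t L) : t ∈ hyperpathCover L := by
  obtain ⟨-, -, h3, -, h5⟩ := h
  exact Or.inl ⟨_, List.getLast_mem h3, h5⟩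

theorem exists_isShortestPath (h : ∃ L, H.IsHyperpath s t L) : ∃ L, H.IsShortestPath s t L := by
  classical
  obtain ⟨L, hL, hmin⟩ := WellFounded.has_min (measure (hyperpathLength (V := V))).wf
    {L | H.IsHyperpath s t L} h
  exact ⟨L, hL, fun L' hL' => not_lt.1 (hmin L' hL')⟩

theorem shortestPathApprox_sqrt_half_card [Fintype V] (H : DirectedHypergraph V) :
    H.ShortestPathApprox (Real.sqrt ((Fintype.card V : ℝ) / 2)) := by
  classical
  refine fun s t hst hex => ⟨exists_isShortestPath hex, fun L Lopt hL hopt => ?_⟩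
  set A : Finset V := (hyperpathCover Lopt).toFinset
  have hk : hyperpathWidth Lopt = A.card := Set.ncard_eq_toFinset_card' _
  have hsA : s ∈ A := by simpa [A] using hopt.1.mem_cover_source
  have htA : t ∈ A := by simpa [A] using hopt.1.mem_cover_target
  obtain ⟨L', hL', hlen⟩ := hopt.1.exists_length_le_choose hst A hsA (by
    intro e he v hv
    exact Set.mem_toFinset.2 (Or.inl ⟨e, he, hv⟩))
  have h2 : 2 ≤ A.card := by
    rw [← Finset.card_pair hst]
    exact Finset.card_le_card (by simp [Finset.insert_subset_iff, hsA, htA])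
  have hW : hyperpathWidth L ≤ A.card.choose 2 + 1 :=
    (hyperpathWidth_le_succ_length L).trans (by have := hL.2 L' hL'; omega)
  have hWn : hyperpathWidth L ≤ Fintype.card V := by
    rw [hyperpathWidth, Set.ncard_eq_toFinset_card']
    exact Finset.card_le_univ _
  rw [hk]
  have h2' : (2 : ℝ) ≤ A.card := by exact_mod_cast h2
  have hW' : (hyperpathWidth L : ℝ) ≤ (A.card : ℝ) * (A.card - 1) / 2 + 1 := by
    rw [← Nat.cast_choose_two]
    exact_mod_cast hW
  have hWn' : (hyperpathWidth L : ℝ) ≤ Fintype.card V := by exact_mod_cast hWn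
  have hW0 : (0 : ℝ) ≤ hyperpathWidth L := Nat.cast_nonneg _
  rw [← abs_of_nonneg hW0, ← Real.sqrt_sq_eq_abs, ← Real.sqrt_sq (by linarith : (0 : ℝ) ≤ A.card),
    ← Real.sqrt_mul (by positivity)]
  apply Real.sqrt_le_sqrt
  calc (hyperpathWidth L : ℝ) ^ 2 = hyperpathWidth L * hyperpathWidth L := sq _
    _ ≤ Fintype.card V * ((A.card : ℝ) ^ 2 / 2) := by
      apply mul_le_mul hWn' _ hW0 (by positivity)
      -- k(k-1)/2 + 1 ≤ k²/2 is exactly k ≥ 2.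
      nlinarith
    _ = _ := by ring

end DirectedHypergraph

/-! ### Ring hypergraphs: packing bound and paths without shortcuts. -/

open MeasureTheory Module in
/-- Volume bound for packings: in a ball of radius `R`, there are at most `(1 + 2 * R / δ) ^ d`
points with pairwise distances at least `δ`. -/
theorem card_le_of_separated {E ι : Type*} [NormedAddCommGroup E] [NormedSpace ℝ E]
    [FiniteDimensional ℝ E] {δ R : ℝ} (hδ : 0 < δ) (hR : 0 ≤ R) (x : E) (f : ι → E)
    (S : Finset ι) (hsep : ∀ i ∈ S, ∀ j ∈ S, i ≠ j → δ ≤ dist (f i) (f j))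
    (hball : ∀ i ∈ S, dist (f i) x ≤ R) :
    (S.card : ℝ) ≤ (1 + 2 * (R / δ)) ^ finrank ℝ E := by
  borelize E
  set μ : Measure E := Measure.addHaar
  -- Balls of radius δ/2 around the points are disjoint and lie in a ball of radius R + δ/2; compare
  -- volumes.
  have hdisj : (S : Set ι).PairwiseDisjoint fun i => Metric.ball (f i) (δ / 2) := by
    intro i hi j hj hij
    apply Metric.ball_disjoint_ball
    have := hsep i hi j hj hij
    linarith
  have hsub : (⋃ i ∈ S, Metric.ball (f i) (δ / 2)) ⊆ Metric.ball x (R + δ / 2) := by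
    simp only [Set.iUnion_subset_iff]
    intro i hi
    apply Metric.ball_subset_ball'
    have := hball i hi
    linarith
  have h1 := measure_mono (μ := μ) hsub
  rw [measure_biUnion_finset hdisj fun _ _ => Metric.isOpen_ball.measurableSet] at h1
  simp only [Measure.addHaar_ball_of_pos μ _ (by positivity : (0 : ℝ) < δ / 2),
    Measure.addHaar_ball_of_pos μ _ (by positivity : (0 : ℝ) < R + δ / 2), Finset.sum_const,
    nsmul_eq_mul, ← mul_assoc] at h1
  have h0 : μ (Metric.ball 0 1) ≠ 0 := (Metric.measure_ball_pos μ _ one_pos).ne'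
  rw [ENNReal.mul_le_mul_iff_left h0 measure_ball_lt_top.ne] at h1
  rw [← ENNReal.ofReal_natCast, ← ENNReal.ofReal_mul (by positivity),
    ENNReal.ofReal_le_ofReal_iff (by positivity)] at h1
  have h2 : 1 + 2 * (R / δ) = (R + δ / 2) / (δ / 2) := by field_simp; ring
  rw [h2, div_pow, le_div_iff₀ (by positivity)]
  exact h1

namespace DirectedHypergraph

variable {V : Type*} {H : DirectedHypergraph V} {s t : V} {L : List (DirectedHyperedge V)}

/-- Among the hyperpaths that use only hyperedges of a given hyperpath, one with the fewest
hyperedges has no shortcuts: no destination set contains the source of a hyperedge after the next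
one, and the source of the path is not met again. -/
theorem IsHyperpath.exists_without_shortcuts (h : H.IsHyperpath s t L) :
    ∃ L', H.IsHyperpath s t L' ∧ (∀ e ∈ L', e ∈ L) ∧
      (∀ i j (hi : i < L'.length) (hj : j < L'.length), i + 2 ≤ j →
        L'[j].src ∉ L'[i].dest) ∧
      ∀ j (hj : j < L'.length), L'[j].src = s → j = 0 := by
  obtain ⟨L', ⟨hL', hsub⟩, hmin⟩ := WellFounded.has_min
    (measure (List.length (α := DirectedHyperedge V))).wf
    {L' | H.IsHyperpath s t L' ∧ ∀ e ∈ L', e ∈ L} ⟨L, h, fun _ => id⟩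
  refine ⟨L', hL', hsub, ?_, ?_⟩
  · intro i j hi hj hij hmem
    refine hmin (L'.take (i + 1) ++ L'.drop j) ⟨(hL'.take hi hmem).append (hL'.drop hj), ?_⟩ ?_
    · intro e he
      rcases List.mem_append.1 he with he | he
      exacts [hsub e (List.mem_of_mem_take he), hsub e (List.mem_of_mem_drop he)]
    · change (L'.take (i + 1) ++ L'.drop j).length < L'.length
      simp only [List.length_append, List.length_take, List.length_drop]
      omega
  · intro j hj hs
    by_contra hj0
    refine hmin (L'.drop j) ⟨hs ▸ hL'.drop hj, fun e he => hsub e (List.mem_of_mem_drop he)⟩ ?_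
    change (L'.drop j).length < L'.length
    simp only [List.length_drop]
    omega

theorem hyperpathLength_eq_sum_fin (L : List (DirectedHyperedge V)) :
    hyperpathLength L = ∑ i : Fin L.length, L[i].dest.card := by
  rw [hyperpathLength, ← List.sum_ofFn]
  congr 1
  apply List.ext_getElem <;> simp

end DirectedHypergraph

open DirectedHypergraph

/-- Only the inclusion of the admissible radii in [r, R] matters, which covers the half-open and the
closed variant at once. -/
theorem ballHypergraph_shortestPathApprox {V : Type*} [Fintype V] {d : ℕ}
    (p : V → EuclideanSpace ℝ (Fin d)) (r R : V → ℝ) (I : V → Set ℝ)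
    (hp : Function.Injective p) (hrR : ∀ v, 0 ≤ r v ∧ r v ≤ R v)
    (hI : ∀ v, I v ⊆ Set.Icc (r v) (R v)) :
    (ballHypergraph p I).ShortestPathApprox (2 * (1 + 2 * ringRatio p r R) ^ d) := by
  classical
  refine fun s t hst hex => ⟨exists_isShortestPath hex, fun L Lopt hL hopt => ?_⟩
  set H := ballHypergraph p I
  have hpos : 0 < (Set.range p).infsep :=
    (Set.finite_range p).infsep_pos_iff_nontrivial.2
      ⟨p s, ⟨s, rfl⟩, p t, ⟨t, rfl⟩, hp.ne hst⟩
  set δ : ℝ := max (⨅ v, r v) (Set.range p).infsep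
  have hδ : 0 < δ := lt_max_of_lt_right hpos
  set M : ℝ := ⨆ v, R v
  have hRM : ∀ v, R v ≤ M := fun v => le_ciSup (Set.finite_range R).bddAbove v
  have hM : 0 ≤ M := ((hrR s).1.trans (hrR s).2).trans (hRM s)
  set B : ℝ := (1 + 2 * ringRatio p r R) ^ d
  have hpack : ∀ (ι : Type) (f : ι → V) (S : Finset ι) (v : V),
      (∀ i ∈ S, ∀ j ∈ S, i ≠ j → δ ≤ dist (p (f i)) (p (f j))) →
      (∀ i ∈ S, dist (p (f i)) (p v) ≤ M) → (S.card : ℝ) ≤ B := by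
    intro ι f S v h1 h2
    have := card_le_of_separated hδ hM (p v) (fun i => p (f i)) S h1 h2
    rwa [finrank_euclideanSpace_fin] at this
  obtain ⟨L', hL', hsub, hshort, hsrc⟩ := hopt.1.exists_without_shortcuts
  set e : Fin L'.length → DirectedHyperedge V := fun i => L'[i]
  have heE : ∀ i, e i ∈ H.edges := fun i => hL'.1 _ (List.getElem_mem _)
  -- the range of a hyperedge
  have hdist : ∀ i, ∀ v ∈ (e i).dest, dist (p (e i).src) (p v) ≤ M := by
    intro i v hv
    obtain ⟨-, x, hx, hxd⟩ := heE i
    rw [dist_comm]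
    exact ((hxd v).1 hv).2.trans ((hI _ hx).2.trans (hRM _))
  -- A repeated source would be a shortcut: for i = 0 the path would return to `s`, and for i > 0
  -- the hyperedge before i would already reach the later source.
  have hne : ∀ i j : Fin L'.length, (i : ℕ) + 2 ≤ j → (e i).src ≠ (e j).src := by
    intro i j hij heq
    obtain ⟨i, hi⟩ := i
    rcases i with _ | i
    · have h0 : L'[0].src = s := by
        rw [← hL'.2.2.2.1, List.head_eq_getElem]
      have := hsrc j j.2 (heq.symm.trans h0)
      simp only at hij
      omega
    · refine hshort i j (by omega) j.2 (by simp only at hij; omega) ?_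
      have hch := List.isChain_iff_getElem.1 hL'.2.1 i hi
      change (e j).src ∈ _
      rw [← heq]
      exact hch
  have hsep : ∀ i j : Fin L'.length, (i : ℕ) + 2 ≤ j →
      δ ≤ dist (p (e i).src) (p (e j).src) := by
    intro i j hij
    refine max_le ?_ ?_
    · obtain ⟨-, x, hx, hxd⟩ := heE i
      have hnot := hshort i j i.2 j.2 hij
      -- The later source is not a destination of `e i`, so it lies outside the ball used there,
      -- whose radius is at least the minimum range.
      have hlt : x < dist (p (e j).src) (p (e i).src) := by
        by_contra hle
        exact hnot ((hxd _).2 ⟨(hne i j hij).symm, not_lt.1 hle⟩)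
      rw [dist_comm]
      exact (ciInf_le (Set.finite_range r).bddBelow _).trans ((hI _ hx).1.trans hlt.le)
    · exact Set.infsep_le_dist_of_mem ⟨_, rfl⟩ ⟨_, rfl⟩ (hp.ne (hne i j hij))
  -- Distinct indices of equal parity differ by at least 2.
  have hsep' : ∀ (S : Finset (Fin L'.length)) (b : ℕ), (∀ i ∈ S, (i : ℕ) % 2 = b) →
      ∀ i ∈ S, ∀ j ∈ S, i ≠ j → δ ≤ dist (p (e i).src) (p (e j).src) := by
    intro S b hS i hi j hj hij
    have h1 := hS i hi
    have h2 := hS j hj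
    have h3 : (i : ℕ) ≠ j := fun h => hij (Fin.ext h)
    rcases Nat.lt_or_ge i j with h | h
    · exact hsep i j (by omega)
    · rw [dist_comm]
      exact hsep j i (by omega)
  -- counting how often a vertex is covered
  have hcount : ∀ v b, ((Finset.univ.filter fun i => v ∈ (e i).dest ∧ (i : ℕ) % 2 = b).card : ℝ)
      ≤ B := by
    intro v b
    refine hpack _ (fun i => (e i).src) _ v (hsep' _ b ?_) ?_
    · intro i hi
      exact (Finset.mem_filter.1 hi).2.2
    · intro i hi
      exact hdist i v (Finset.mem_filter.1 hi).2.1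
  have hL0 : 0 < L'.length := hL'.length_pos
  -- The first hyperedge has an even index and is rooted at `s` itself without covering `s`, so it
  -- can join the packing around `s`. The unit saved here absorbs the +1 between length and width.
  have hcount_s : ((Finset.univ.filter fun i => s ∈ (e i).dest ∧ (i : ℕ) % 2 = 0).card : ℝ) + 1
      ≤ B := by
    have h0 : (e ⟨0, hL0⟩).src = s := by
      rw [← hL'.2.2.2.1, List.head_eq_getElem]
      rfl
    have hnot : (⟨0, hL0⟩ : Fin L'.length) ∉
        Finset.univ.filter fun i => s ∈ (e i).dest ∧ (i : ℕ) % 2 = 0 := by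
      intro h
      refine H.src_notMem_dest _ (heE ⟨0, hL0⟩) ?_
      rw [h0]
      exact (Finset.mem_filter.1 h).2.1
    have := hpack _ (fun i => (e i).src) (insert ⟨0, hL0⟩
      (Finset.univ.filter fun i => s ∈ (e i).dest ∧ (i : ℕ) % 2 = 0)) s (hsep' _ 0 ?_) ?_
    · rw [Finset.card_insert_of_notMem hnot] at this
      exact_mod_cast this
    · intro i hi
      rcases Finset.mem_insert.1 hi with rfl | hi
      · rfl
      · exact (Finset.mem_filter.1 hi).2.2
    · intro i hi
      rcases Finset.mem_insert.1 hi with rfl | hi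
      · rw [h0, dist_self]
        exact hM
      · exact hdist i s (Finset.mem_filter.1 hi).2.1
  have hsplit : ∀ v, (Finset.univ.filter fun i => v ∈ (e i).dest).card =
      (Finset.univ.filter fun i => v ∈ (e i).dest ∧ (i : ℕ) % 2 = 0).card +
      (Finset.univ.filter fun i => v ∈ (e i).dest ∧ (i : ℕ) % 2 = 1).card := by
    intro v
    rw [← Finset.card_filter_add_card_filter_not (fun i : Fin L'.length => (i : ℕ) % 2 = 0),
      Finset.filter_filter, Finset.filter_filter]
    simp only [Nat.mod_two_not_eq_zero]
  set A : Finset V := (hyperpathCover Lopt).toFinset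
  have hk : hyperpathWidth Lopt = A.card := Set.ncard_eq_toFinset_card' _
  have hsA : s ∈ A := Set.mem_toFinset.2 hopt.1.mem_cover_source
  have hdestA : ∀ i, (e i).dest ⊆ A := fun i v hv =>
    Set.mem_toFinset.2 (Or.inl ⟨_, hsub _ (List.getElem_mem _), hv⟩)
  have hlen : hyperpathLength L' =
      ∑ v ∈ A, (Finset.univ.filter fun i => v ∈ (e i).dest).card := by
    rw [hyperpathLength_eq_sum_fin]
    simp only [Finset.card_filter]
    rw [Finset.sum_comm]
    refine Finset.sum_congr rfl fun i _ => ?_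
    rw [← Finset.card_filter, Finset.filter_mem_eq_inter, Finset.inter_eq_right.2 (hdestA i)]
  have hbound : (hyperpathLength L' : ℝ) + 1 ≤ 2 * B * A.card := by
    rw [hlen, ← Finset.add_sum_erase _ _ hsA]
    push_cast
    have h1 : (((Finset.univ.filter fun i => s ∈ (e i).dest).card : ℕ) : ℝ) + 1 ≤ 2 * B := by
      rw [hsplit]
      push_cast
      linarith [hcount s 1]
    have h2 : ∑ v ∈ A.erase s, ((Finset.univ.filter fun i => v ∈ (e i).dest).card : ℝ) ≤
        (A.erase s).card * (2 * B) := by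
      rw [← nsmul_eq_mul]
      refine Finset.sum_le_card_nsmul _ _ _ fun v _ => ?_
      rw [hsplit]
      push_cast
      linarith [hcount v 0, hcount v 1]
    have h3 : ((A.erase s).card : ℝ) + 1 = A.card := by
      exact_mod_cast Finset.card_erase_add_one hsA
    rw [← h3]
    linarith
  have hfin : (hyperpathWidth L : ℝ) ≤ hyperpathLength L' + 1 := by
    exact_mod_cast (hyperpathWidth_le_succ_length L).trans (Nat.add_le_add_right (hL.2 L' hL') 1)
  rw [hk]
  linarith

/-! ### Tight example: points and ranges. -/

/-- The vertices of the tight example: a chain of points `(2 ^ i, 0)`, which carries the thin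
path, a column of points `(0, (3 / 2) ^ j)` and a column of points descending to the target,
which together carry the short path. -/
abbrev TightVertex (K J M : ℕ) : Type := Fin (K + 1) ⊕ Fin J ⊕ Fin (M + 1)

namespace TightVertex

variable {K J M : ℕ}

/-- First coordinate of a vertex. -/
noncomputable def xCoord : TightVertex K J M → ℝ
  | .inl i => 2 ^ (i : ℕ)
  | .inr (.inl _) => 0
  | .inr (.inr _) => (3 / 2) ^ J

/-- Second coordinate of a vertex. -/
noncomputable def yCoord : TightVertex K J M → ℝ
  | .inl _ => 0
  | .inr (.inl j) => (3 / 2) ^ ((j : ℕ) + 1)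
  | .inr (.inr m) => (3 / 2) ^ J / 2 ^ (m : ℕ)

/-- Maximum range of a vertex. -/
noncomputable def range : TightVertex K J M → ℝ
  | .inl i => if (i : ℕ) = 0 then 2 else if (i : ℕ) < K then 2 ^ (i : ℕ) else
      √((2 ^ K - (3 / 2) ^ J) ^ 2 + ((3 / 2) ^ J / 2 ^ M) ^ 2)
  | .inr (.inl j) => if (j : ℕ) + 1 < J then (3 / 2) ^ ((j : ℕ) + 1) / 2 else (3 / 2) ^ J
  | .inr (.inr m) => if (m : ℕ) < M then (3 / 2) ^ J / 2 ^ ((m : ℕ) + 1) else 0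

/-- Squared distance of two vertices. -/
noncomputable def sqDist (a b : TightVertex K J M) : ℝ :=
  (xCoord a - xCoord b) ^ 2 + (yCoord a - yCoord b) ^ 2

/-- The vertex `b` is within the range of the vertex `a`. -/
def Reaches (a b : TightVertex K J M) : Prop :=
  sqDist a b ≤ range a ^ 2

theorem range_nonneg (a : TightVertex K J M) : 0 ≤ range a := by
  rcases a with i | j | m <;> simp only [range] <;> split_ifs <;> positivity

theorem coord_injective : Function.Injective fun a : TightVertex K J M => (xCoord a, yCoord a) := by
  rintro (i | j | m) (i' | j' | m') h <;> simp only [xCoord, yCoord, Prod.mk.injEq] at h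
  · have := pow_right_injective₀ (by norm_num : (0 : ℝ) < 2) (by norm_num) h.1
    rw [Fin.ext this]
  · exact absurd h.1 (by positivity)
  · have : (0 : ℝ) < (3 / 2) ^ J / 2 ^ (m' : ℕ) := by positivity
    exact absurd h.2 this.ne
  · exact absurd h.1.symm (by positivity)
  · have := pow_right_injective₀ (by norm_num : (0 : ℝ) < 3 / 2) (by norm_num) h.2
    rw [Fin.ext (Nat.succ_injective this)]
  · have : (0 : ℝ) < (3 / 2) ^ J := by positivity
    exact absurd h.1 this.ne
  · have : (0 : ℝ) < (3 / 2) ^ J / 2 ^ (m : ℕ) := by positivity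
    exact absurd h.2.symm this.ne
  · have : (0 : ℝ) < (3 / 2) ^ J := by positivity
    exact absurd h.1.symm this.ne
  · have h2 := h.2
    rw [div_eq_div_iff (by positivity) (by positivity)] at h2
    have := pow_right_injective₀ (by norm_num : (0 : ℝ) < 2) (by norm_num)
      (mul_left_cancel₀ (by positivity) h2).symm
    rw [Fin.ext this]

theorem two_pow_mul_le {i j k : ℕ} (h : i + k ≤ j) : (2 : ℝ) ^ k * 2 ^ i ≤ 2 ^ j := by
  rw [← pow_add, add_comm]
  exact pow_le_pow_right₀ (by norm_num) h

theorem three_halves_pow_mul_le {i j k : ℕ} (h : i + k ≤ j) :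
    (3 / 2 : ℝ) ^ k * (3 / 2) ^ i ≤ (3 / 2) ^ j := by
  rw [← pow_add, add_comm]
  exact pow_le_pow_right₀ (by norm_num) h

/-! ### Tight example: which vertices are in range of which. -/

section Reaches

theorem le_succ_of_reaches_chain {i j : Fin (K + 1)}
    (h : Reaches (.inl i : TightVertex K J M) (.inl j)) : (j : ℕ) ≤ i + 1 := by
  by_contra! hlt
  have h1 := two_pow_mul_le (by omega : (i : ℕ) + 2 ≤ j)
  have hi : (1 : ℝ) ≤ 2 ^ (i : ℕ) := one_le_pow₀ (by norm_num)
  have hiK : (i : ℕ) < K := by have := j.2; omega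
  simp only [Reaches, sqDist, xCoord, yCoord, range, hiK, if_true] at h
  split_ifs at h with h0
  · rw [h0] at h h1
    norm_num at h h1
    nlinarith
  · nlinarith

/-- An inner chain point has range 2^i, its distance to the origin, and so misses the column above.
For the last one, `hX2` bounds the horizontal part of its range by 2^K, and `hM` makes the vertical
part at most 1, below every column point. -/
theorem reaches_chain_column (hX1 : (2 : ℝ) ^ K < (3 / 2) ^ J)
    (hX2 : (3 / 2 : ℝ) ^ J ≤ 2 ^ (K + 1)) (hM : K + 1 ≤ M) {i : Fin (K + 1)} {j : Fin J}
    (h : Reaches (.inl i : TightVertex K J M) (.inr (.inl j))) : (i : ℕ) = 0 ∧ (j : ℕ) = 0 := by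
  have hj : (1 : ℝ) < (3 / 2) ^ ((j : ℕ) + 1) := one_lt_pow₀ (by norm_num) (by omega)
  simp only [Reaches, sqDist, xCoord, yCoord, range] at h
  split_ifs at h with h0 h1
  · refine ⟨h0, ?_⟩
    by_contra hj0
    have h2 := three_halves_pow_mul_le (by omega : 0 + 2 ≤ (j : ℕ) + 1)
    rw [h0] at h
    norm_num at h h2
    nlinarith
  · nlinarith
  · exfalso
    rw [Real.sq_sqrt (by positivity)] at h
    have hi : (i : ℕ) = K := by have := i.2; omega
    have hXM : (3 / 2 : ℝ) ^ J / 2 ^ M ≤ 1 := by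
      rw [div_le_one (by positivity)]
      exact hX2.trans (pow_le_pow_right₀ (by norm_num) hM)
    have hXM0 : 0 ≤ (3 / 2 : ℝ) ^ J / 2 ^ M := by positivity
    rw [hi] at h
    rw [pow_succ] at hX2
    generalize (3 / 2 : ℝ) ^ J / 2 ^ M = z at *
    generalize (3 / 2 : ℝ) ^ J = x at *
    generalize (2 : ℝ) ^ K = y at *
    nlinarith

/-- The descent lies at abscissa (3/2)^J > 2^K, too far for every chain point but the last, whose
range is exactly its distance to the lowest, hence nearest, descent point. -/
theorem reaches_chain_descent (hK : 2 ≤ K) (hX1 : (2 : ℝ) ^ K < (3 / 2) ^ J)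
    {i : Fin (K + 1)} {m : Fin (M + 1)}
    (h : Reaches (.inl i : TightVertex K J M) (.inr (.inr m))) : (i : ℕ) = K ∧ (m : ℕ) = M := by
  simp only [Reaches, sqDist, xCoord, yCoord, range] at h
  split_ifs at h with h0 h1
  · exfalso
    have h2 := two_pow_mul_le (by omega : 0 + 2 ≤ K)
    rw [h0] at h
    norm_num at h h2
    nlinarith [sq_nonneg ((3 / 2 : ℝ) ^ J / 2 ^ (m : ℕ))]
  · exfalso
    have h2 := two_pow_mul_le (by omega : (i : ℕ) + 1 ≤ K)
    have h3 : (0 : ℝ) < 2 ^ (i : ℕ) := by positivity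
    nlinarith [sq_nonneg ((3 / 2 : ℝ) ^ J / 2 ^ (m : ℕ))]
  · rw [Real.sq_sqrt (by positivity)] at h
    have hi : (i : ℕ) = K := by have := i.2; omega
    refine ⟨hi, ?_⟩
    rw [hi] at h
    have h4 : (3 / 2 : ℝ) ^ J / 2 ^ (m : ℕ) ≤ (3 / 2) ^ J / 2 ^ M := by
      refine (sq_le_sq₀ (by positivity) (by positivity)).1 ?_
      linarith
    rw [div_le_div_iff_of_pos_left (by positivity) (by positivity) (by positivity),
      pow_le_pow_iff_right₀ (by norm_num)] at h4
    have := m.2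
    omega

theorem not_reaches_column_chain {j : Fin J} {i : Fin (K + 1)} :
    ¬ Reaches (.inr (.inl j) : TightVertex K J M) (.inl i) := by
  intro h
  have h1 : (0 : ℝ) < 2 ^ (i : ℕ) := by positivity
  have h2 : (0 : ℝ) < (3 / 2) ^ ((j : ℕ) + 1) := by positivity
  simp only [Reaches, sqDist, xCoord, yCoord, range] at h
  split_ifs at h with h0
  · nlinarith
  · rw [show (j : ℕ) + 1 = J by have := j.2; omega] at h
    nlinarith

/-- From height y with range y/2, the neighbours 3y/2 and 2y/3 are reached, whereas 9y/4 and 4y/9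
are not. This keeps each column step at cost 2. -/
theorem reaches_column_column {j j' : Fin J} (hj : (j : ℕ) + 1 < J)
    (h : Reaches (.inr (.inl j) : TightVertex K J M) (.inr (.inl j'))) :
    (j' : ℕ) ≤ j + 1 ∧ (j : ℕ) ≤ j' + 1 := by
  have h0 : (0 : ℝ) < (3 / 2) ^ ((j : ℕ) + 1) := by positivity
  have h0' : (0 : ℝ) < (3 / 2) ^ ((j' : ℕ) + 1) := by positivity
  simp only [Reaches, sqDist, xCoord, yCoord, range, if_pos hj] at h
  constructor
  · by_contra! hlt
    have := three_halves_pow_mul_le (by omega : ((j : ℕ) + 1) + 2 ≤ (j' : ℕ) + 1)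
    nlinarith
  · by_contra! hlt
    have := three_halves_pow_mul_le (by omega : ((j' : ℕ) + 1) + 2 ≤ (j : ℕ) + 1)
    nlinarith

theorem reaches_column_descent {j : Fin J} {m : Fin (M + 1)}
    (h : Reaches (.inr (.inl j) : TightVertex K J M) (.inr (.inr m))) :
    (j : ℕ) + 1 = J ∧ (m : ℕ) = 0 := by
  have hX : (0 : ℝ) < (3 / 2) ^ J := by positivity
  simp only [Reaches, sqDist, xCoord, yCoord, range] at h
  split_ifs at h with h0
  · exfalso
    have h1 := three_halves_pow_mul_le (by omega : ((j : ℕ) + 1) + 0 ≤ J)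
    have h2 : (0 : ℝ) < (3 / 2) ^ ((j : ℕ) + 1) := by positivity
    nlinarith [sq_nonneg ((3 / 2 : ℝ) ^ ((j : ℕ) + 1) - (3 / 2) ^ J / 2 ^ (m : ℕ))]
  · have hj : (j : ℕ) + 1 = J := by have := j.2; omega
    refine ⟨hj, ?_⟩
    rw [hj] at h
    have h3 : (3 / 2 : ℝ) ^ J - (3 / 2) ^ J / 2 ^ (m : ℕ) = 0 := by
      apply pow_eq_zero_iff (two_ne_zero) |>.1
      nlinarith [sq_nonneg ((3 / 2 : ℝ) ^ J - (3 / 2) ^ J / 2 ^ (m : ℕ))]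
    by_contra hm
    have h4 : (3 / 2 : ℝ) ^ J / 2 ^ (m : ℕ) < (3 / 2) ^ J :=
      div_lt_self hX (one_lt_pow₀ (by norm_num) hm)
    linarith

theorem not_reaches_descent_chain {m : Fin (M + 1)} {i : Fin (K + 1)} :
    ¬ Reaches (.inr (.inr m) : TightVertex K J M) (.inl i) := by
  intro h
  have h1 : (0 : ℝ) < (3 / 2) ^ J / 2 ^ (m : ℕ) := by positivity
  simp only [Reaches, sqDist, xCoord, yCoord, range] at h
  split_ifs at h with h0
  · rw [pow_succ (2 : ℝ), ← div_div] at h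
    nlinarith [sq_nonneg ((3 / 2 : ℝ) ^ J - 2 ^ (i : ℕ))]
  · nlinarith [sq_nonneg ((3 / 2 : ℝ) ^ J - 2 ^ (i : ℕ))]

theorem not_reaches_descent_column {m : Fin (M + 1)} {j : Fin J} :
    ¬ Reaches (.inr (.inr m) : TightVertex K J M) (.inr (.inl j)) := by
  intro h
  have hX : (0 : ℝ) < (3 / 2) ^ J := by positivity
  simp only [Reaches, sqDist, xCoord, yCoord, range] at h
  have h2 : (3 / 2 : ℝ) ^ J / 2 ^ ((m : ℕ) + 1) < (3 / 2) ^ J :=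
    div_lt_self hX (one_lt_pow₀ (by norm_num) (by omega))
  have h3 : (0 : ℝ) < (3 / 2 : ℝ) ^ J / 2 ^ ((m : ℕ) + 1) := by positivity
  split_ifs at h with h0
  · nlinarith [sq_nonneg ((3 / 2 : ℝ) ^ J / 2 ^ (m : ℕ) - (3 / 2) ^ ((j : ℕ) + 1))]
  · nlinarith [sq_nonneg ((3 / 2 : ℝ) ^ J / 2 ^ (m : ℕ) - (3 / 2) ^ ((j : ℕ) + 1))]

/-- Heights halve and the range is half the height, so the next point down is just reached, while
the previous one is twice too far away. Descent steps thus cost 1 and cannot be skipped. -/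
theorem reaches_descent_descent {m m' : Fin (M + 1)} (hmm : m' ≠ m)
    (h : Reaches (.inr (.inr m) : TightVertex K J M) (.inr (.inr m'))) :
    (m' : ℕ) = m + 1 := by
  have hne : (m' : ℕ) ≠ m := fun h => hmm (Fin.ext h)
  have h1 : (0 : ℝ) < (3 / 2) ^ J / 2 ^ (m : ℕ) := by positivity
  have h1' : (0 : ℝ) < (3 / 2) ^ J / 2 ^ (m' : ℕ) := by positivity
  have hstep : ∀ {a b k : ℕ}, a + k ≤ b →
      (2 : ℝ) ^ k * ((3 / 2) ^ J / 2 ^ b) ≤ (3 / 2) ^ J / 2 ^ a := by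
    intro a b k hab
    rw [← mul_div_assoc, div_le_div_iff₀ (by positivity) (by positivity)]
    nlinarith [two_pow_mul_le hab, (by positivity : (0 : ℝ) < (3 / 2) ^ J)]
  simp only [Reaches, sqDist, xCoord, yCoord, range] at h
  split_ifs at h with h0
  · rw [pow_succ (2 : ℝ), ← div_div] at h
    rcases Nat.lt_or_gt_of_ne hne with hlt | hgt
    · have := hstep (by omega : (m' : ℕ) + 1 ≤ m)
      nlinarith
    · by_contra hne'
      have := hstep (by omega : (m : ℕ) + 2 ≤ m')
      nlinarith
  · have hlt : (m' : ℕ) + 1 ≤ m := by have := m.2; have := m'.2; omega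
    have := hstep hlt
    nlinarith

theorem reaches_chain_succ {i : ℕ} (hi : i + 1 < K + 1) :
    Reaches (.inl ⟨i, by omega⟩ : TightVertex K J M) (.inl ⟨i + 1, hi⟩) := by
  have hi' : i < K := by omega
  simp only [Reaches, sqDist, xCoord, yCoord, range, hi', if_true]
  split_ifs with h0
  · norm_num [h0]
  · rw [pow_succ (2 : ℝ)]
    nlinarith [sq_nonneg ((2 : ℝ) ^ i)]

theorem reaches_chain_target (hK : K ≠ 0) :
    Reaches (.inl ⟨K, by omega⟩ : TightVertex K J M) (.inr (.inr ⟨M, by omega⟩)) := by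
  simp only [Reaches, sqDist, xCoord, yCoord, range, hK, if_false, lt_irrefl]
  rw [Real.sq_sqrt (by positivity)]
  simp

theorem reaches_source_column (hJ : 0 < J) :
    Reaches (.inl ⟨0, by omega⟩ : TightVertex K J M) (.inr (.inl ⟨0, hJ⟩)) := by
  simp only [Reaches, sqDist, xCoord, yCoord, range, if_true]
  norm_num

theorem reaches_column_succ {j : ℕ} (hj : j + 1 < J) :
    Reaches (.inr (.inl ⟨j, by omega⟩) : TightVertex K J M) (.inr (.inl ⟨j + 1, hj⟩)) := by
  simp only [Reaches, sqDist, xCoord, yCoord, range, hj, if_true]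
  rw [pow_succ (3 / 2 : ℝ) (j + 1)]
  nlinarith

theorem reaches_column_descent_zero {j : ℕ} (hj : j + 1 = J) :
    Reaches (.inr (.inl ⟨j, by omega⟩) : TightVertex K J M) (.inr (.inr ⟨0, by omega⟩)) := by
  simp only [Reaches, sqDist, xCoord, yCoord, range, hj, if_false, lt_irrefl]
  simp

theorem reaches_descent_succ {m : ℕ} (hm : m + 1 < M + 1) :
    Reaches (.inr (.inr ⟨m, by omega⟩) : TightVertex K J M) (.inr (.inr ⟨m + 1, hm⟩)) := by
  have hm' : m < M := by omega
  simp only [Reaches, sqDist, xCoord, yCoord, range, hm', if_true]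
  rw [pow_succ (2 : ℝ), ← div_div]
  nlinarith

/-- This makes the chain expensive: a ball around point i that contains point i + 1 contains all
earlier chain points too. -/
theorem sqDist_chain_le {i k : ℕ} (hi : i + 1 < K + 1) (hk : k ≤ i + 1) :
    sqDist (.inl ⟨i, by omega⟩ : TightVertex K J M) (.inl ⟨k, by omega⟩) ≤
      sqDist (.inl ⟨i, by omega⟩ : TightVertex K J M) (.inl ⟨i + 1, hi⟩) := by
  simp only [sqDist, xCoord, yCoord]
  have h1 : (2 : ℝ) ^ k ≤ 2 ^ (i + 1) := pow_le_pow_right₀ (by norm_num) hk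
  have h2 : (0 : ℝ) < 2 ^ k := by positivity
  rw [pow_succ (2 : ℝ)] at h1 ⊢
  nlinarith

end Reaches

end TightVertex

/-! ### Tight example: the hypergraph, its thin path and its short path. -/

namespace DirectedHypergraph

/-- A potential that grows along no hyperedge by more than its weight bounds the length of a
hyperpath from below. -/
theorem IsHyperpath.potential_le {V : Type*} {H : DirectedHypergraph V} {s t : V}
    {L : List (DirectedHyperedge V)} (φ : V → ℕ) (h : H.IsHyperpath s t L)
    (hφ : ∀ f ∈ L, ∀ u ∈ f.dest, φ u ≤ φ f.src + f.dest.card) :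
    φ t ≤ φ s + hyperpathLength L := by
  induction L using List.reverseRecOn generalizing t with
  | nil => exact absurd rfl h.ne_nil
  | append_singleton L f ih =>
    rw [isHyperpath_concat_iff] at h
    obtain ⟨-, ht, h⟩ := h
    have h1 := hφ f (by simp) t ht
    rw [hyperpathLength_append, hyperpathLength_singleton]
    rcases h with ⟨rfl, rfl⟩ | h
    · omega
    · have := ih h fun g hg => hφ g (by simp [hg])
      omega

end DirectedHypergraph

open DirectedHypergraph

namespace TightVertex

variable {K J M : ℕ}

/-- The position of a vertex in the plane. -/
noncomputable def point (a : TightVertex K J M) : EuclideanSpace ℝ (Fin 2) :=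
  !₂[xCoord a, yCoord a]

theorem dist_point_le_iff {a b : TightVertex K J M} {x : ℝ} (hx : 0 ≤ x) :
    dist (point b) (point a) ≤ x ↔ sqDist a b ≤ x ^ 2 := by
  rw [dist_comm, EuclideanSpace.dist_eq, Real.sqrt_le_left hx]
  simp [Fin.sum_univ_two, point, sqDist, Real.dist_eq]

theorem point_injective : Function.Injective (point : TightVertex K J M → _) := by
  intro a b h
  apply coord_injective
  have h0 := congrFun (congrArg WithLp.ofLp h) 0
  have h1 := congrFun (congrArg WithLp.ofLp h) 1
  simp only [point] at h0 h1
  exact Prod.ext (by simpa using h0) (by simpa using h1)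

/-- The first vertex of the chain. -/
def source : TightVertex K J M := .inl ⟨0, by omega⟩

/-- The last vertex of the descent. -/
def target : TightVertex K J M := .inr (.inr ⟨M, by omega⟩)

/-- A lower bound for the length of the hyperpaths to a vertex that do not use the descent. -/
def potential : TightVertex K J M → ℕ
  | .inl i => ((i : ℕ) + 1).choose 2
  | .inr (.inl _) => 0
  | .inr (.inr m) => if (m : ℕ) = M then (K + 1).choose 2 else 0

variable {V : Type*} (e : V ≃ TightVertex K J M)

/-- The disk hypergraph of the tight example. -/
noncomputable abbrev hypergraph : DirectedHypergraph V :=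
  diskHypergraph (fun v => point (e v)) (fun v => range (e v))

variable {e}

theorem ne_and_reaches {f : DirectedHyperedge V} (hf : f ∈ (hypergraph e).edges) {u : V}
    (hu : u ∈ f.dest) : u ≠ f.src ∧ 0 < range (e f.src) ∧ Reaches (e f.src) (e u) := by
  obtain ⟨-, x, hx, hxd⟩ := hf
  have h := (hxd u).1 hu
  refine ⟨h.1, hx.1.trans_le hx.2, ?_⟩
  exact (dist_point_le_iff (range_nonneg _)).1 (h.2.trans hx.2)

theorem mem_dest_of_sqDist_le {f : DirectedHyperedge V} (hf : f ∈ (hypergraph e).edges) {u v : V}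
    (hu : u ∈ f.dest) (hv : v ≠ f.src) (h : sqDist (e f.src) (e v) ≤ sqDist (e f.src) (e u)) :
    v ∈ f.dest := by
  obtain ⟨-, x, hx, hxd⟩ := hf
  rw [hxd]
  refine ⟨hv, (dist_point_le_iff hx.1.le).2 (h.trans ?_)⟩
  exact (dist_point_le_iff hx.1.le).1 ((hxd u).1 hu).2

section FullEdge

variable [Fintype V]

open Classical in
variable (e) in
/-- The hyperedge in which a vertex transmits with its maximum range. -/
noncomputable def fullEdge (a : TightVertex K J M) : DirectedHyperedge V where
  src := e.symm a
  dest := Finset.univ.filter fun v => e v ≠ a ∧ Reaches a (e v)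

theorem mem_fullEdge_dest {a : TightVertex K J M} {v : V} :
    v ∈ (fullEdge e a).dest ↔ e v ≠ a ∧ Reaches a (e v) := by
  simp [fullEdge]

theorem fullEdge_mem_edges {a b : TightVertex K J M} (hab : b ≠ a) (h : Reaches a b) :
    fullEdge e a ∈ (hypergraph e).edges := by
  refine ⟨⟨e.symm b, mem_fullEdge_dest.2 (by simpa using ⟨hab, h⟩)⟩, range a, ⟨?_, ?_⟩, ?_⟩
  · refine lt_of_le_of_ne (range_nonneg a) fun h0 => hab ?_
    have := (dist_point_le_iff (range_nonneg a)).2 h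
    rw [← h0] at this
    exact point_injective (dist_le_zero.1 this)
  · simp [fullEdge]
  · intro v
    rw [mem_fullEdge_dest, dist_point_le_iff (range_nonneg a)]
    simp [fullEdge, Reaches, Equiv.eq_symm_apply]

theorem isHyperpath_fullEdge {a b : TightVertex K J M} (hab : b ≠ a) (h : Reaches a b) :
    (hypergraph e).IsHyperpath (e.symm a) (e.symm b) [fullEdge e a] :=
  isHyperpath_singleton (fullEdge_mem_edges hab h)
    (mem_fullEdge_dest.2 (by simpa using ⟨hab, h⟩))

theorem card_fullEdge_dest_le {a : TightVertex K J M} (S : Finset (TightVertex K J M))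
    (h : ∀ b, b ≠ a → Reaches a b → b ∈ S) : (fullEdge e a).dest.card ≤ S.card := by
  rw [← Finset.card_map e.toEmbedding]
  refine Finset.card_le_card fun b hb => ?_
  obtain ⟨v, hv, rfl⟩ := Finset.mem_map.1 hb
  have := mem_fullEdge_dest.1 hv
  exact h _ this.1 this.2

end FullEdge

/-- The assumptions on the parameters of the example. -/
structure Admissible (K J M : ℕ) : Prop where
  two_le : 2 ≤ K
  lt_pow : (2 : ℝ) ^ K < (3 / 2) ^ J
  pow_le : (3 / 2 : ℝ) ^ J ≤ 2 ^ (K + 1)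
  succ_le : K + 1 ≤ M

theorem Admissible.pos (hA : Admissible K J M) : 0 < J := by
  rcases Nat.eq_zero_or_pos J with rfl | h
  · have h1 := hA.lt_pow
    have h2 : (1 : ℝ) ≤ 2 ^ K := one_le_pow₀ (by norm_num)
    rw [pow_zero] at h1
    linarith
  · exact h

section Bounds

variable [Fintype V]

theorem exists_thin_hyperpath (hA : Admissible K J M) :
    ∃ L, (hypergraph e).IsHyperpath (e.symm source) (e.symm target) L ∧
      hyperpathWidth L ≤ K + 3 := by
  classical
  have hK := hA.two_le
  -- Everything the chain can reach: the chain, the first column point (from the source) and the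
  -- target (from the last chain point).
  set G : Finset V := ((Finset.univ.map Function.Embedding.inl) ∪
    {.inr (.inl ⟨0, hA.pos⟩), target}).map e.symm.toEmbedding with hG
  have hGcard : G.card ≤ K + 3 := by
    rw [hG, Finset.card_map]
    refine (Finset.card_union_le _ _).trans ?_
    rw [Finset.card_map, Finset.card_univ, Fintype.card_fin]
    have := Finset.card_le_two (a := (.inr (.inl ⟨0, hA.pos⟩) : TightVertex K J M)) (b := target)
    omega
  have hchain : ∀ i, e.symm (.inl i) ∈ G := fun i =>
    Finset.mem_map.2 ⟨.inl i, by simp, rfl⟩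
  have hfull : ∀ i, (fullEdge e (.inl i)).dest ⊆ G := by
    intro i v hv
    have h := (mem_fullEdge_dest.1 hv).2
    rw [← e.symm_apply_apply v]
    rcases hev : e v with i' | j | m <;> rw [hev] at h
    · exact hchain i'
    · have := reaches_chain_column hA.lt_pow hA.pow_le hA.succ_le h
      refine Finset.mem_map.2 ⟨.inr (.inl j), ?_, rfl⟩
      have hj : j = ⟨0, hA.pos⟩ := Fin.ext this.2
      simp [hj]
    · have := reaches_chain_descent hA.two_le hA.lt_pow h
      refine Finset.mem_map.2 ⟨.inr (.inr m), ?_, rfl⟩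
      have hm : m = ⟨M, by omega⟩ := Fin.ext this.2
      simp [hm, target]
  have hstep : ∀ i (hi : i + 1 < K + 1),
      ∃ L, (hypergraph e).IsHyperpath (e.symm source) (e.symm (.inl ⟨i + 1, hi⟩)) L ∧
        ∀ f ∈ L, f.dest ⊆ G := by
    intro i
    induction i with
    | zero =>
      intro hi
      refine ⟨_, isHyperpath_fullEdge (by simp [source]) (reaches_chain_succ hi), ?_⟩
      intro f hf
      rw [List.mem_singleton.1 hf]
      exact hfull _
    | succ i ih =>
      intro hi
      obtain ⟨L, hL, hLG⟩ := ih (by omega)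
      refine ⟨_, hL.append (isHyperpath_fullEdge (by simp) (reaches_chain_succ hi)), ?_⟩
      intro f hf
      rcases List.mem_append.1 hf with hf | hf
      · exact hLG f hf
      · rw [List.mem_singleton.1 hf]
        exact hfull _
  obtain ⟨L, hL, hLG⟩ := hstep (K - 1) (by omega)
  simp only [Nat.sub_add_cancel (by omega : 1 ≤ K)] at hL
  have hL' := hL.append (isHyperpath_fullEdge (b := target) (by simp [target])
    (reaches_chain_target (by omega)))
  refine ⟨_, hL', le_trans ?_ hGcard⟩
  rw [hyperpathWidth, ← Set.ncard_coe_finset]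
  refine Set.ncard_le_ncard ?_ G.finite_toSet
  rintro v (⟨f, hf, hv⟩ | ⟨f, hf, hv⟩)
  · rcases List.mem_append.1 hf with hf | hf
    · exact hLG f hf hv
    · rw [List.mem_singleton.1 hf] at hv
      exact hfull _ hv
  · rw [List.head?_eq_some_head hL'.ne_nil] at hf
    simp only [Option.mem_def, Option.some.injEq] at hf
    rw [hv, ← hf, hL'.2.2.2.1]
    exact hchain _

/-- Costs: 2 for the first step, 2 for each of the J - 1 column steps, at most J + 1 for the jump to
the top of the descent, and 1 for each of the M descent steps. -/
theorem exists_short_hyperpath (hA : Admissible K J M) :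
    ∃ L, (hypergraph e).IsHyperpath (e.symm source) (e.symm target) L ∧
      hyperpathLength L ≤ 3 * J + 1 + M := by
  classical
  have hJ := hA.pos
  have hcolumn : ∀ j (hj : j < J),
      ∃ L, (hypergraph e).IsHyperpath (e.symm source) (e.symm (.inr (.inl ⟨j, hj⟩))) L ∧
        hyperpathLength L ≤ 2 * j + 2 := by
    intro j
    induction j with
    | zero =>
      intro hj
      refine ⟨_, isHyperpath_fullEdge (by simp [source]) (reaches_source_column hj), ?_⟩
      rw [hyperpathLength_singleton]
      refine (card_fullEdge_dest_le {.inl ⟨1, by have := hA.two_le; omega⟩, .inr (.inl ⟨0, hj⟩)}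
        ?_).trans Finset.card_le_two
      rintro (i | j | m) hne h
      · have h1 := le_succ_of_reaches_chain h
        have h2 : (i : ℕ) ≠ 0 := fun h0 => hne (by simp [source, Fin.ext_iff, h0])
        have : i = ⟨1, by have := hA.two_le; omega⟩ := Fin.ext (by simp at h1 ⊢; omega)
        simp [this]
      · have := (reaches_chain_column hA.lt_pow hA.pow_le hA.succ_le h).2
        simp [Fin.ext_iff, this]
      · have := (reaches_chain_descent hA.two_le hA.lt_pow h).1
        have := hA.two_le
        simp at *
        omega
    | succ j ih =>
      intro hj
      obtain ⟨L, hL, hlen⟩ := ih (by omega)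
      refine ⟨_, hL.append (isHyperpath_fullEdge (by simp) (reaches_column_succ hj)), ?_⟩
      rw [hyperpathLength_append, hyperpathLength_singleton]
      have : (fullEdge e (.inr (.inl ⟨j, by omega⟩))).dest.card ≤ 2 := by
        -- For j = 0 the truncated `j - 1` is the vertex itself, a harmless extra element.
        refine (card_fullEdge_dest_le
          {.inr (.inl ⟨j - 1, by omega⟩), .inr (.inl ⟨j + 1, hj⟩)} ?_).trans Finset.card_le_two
        rintro (i | j' | m) hne h
        · exact absurd h not_reaches_column_chain
        · have h1 := reaches_column_column (by simpa using hj) h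
          have h2 : (j' : ℕ) ≠ j := fun h0 => hne (by simp [Fin.ext_iff, h0])
          simp only [Finset.mem_insert, Finset.mem_singleton, Sum.inr.injEq, Sum.inl.injEq,
            Fin.ext_iff] at h1 ⊢
          omega
        · have := (reaches_column_descent h).1
          simp only at this
          omega
      omega
  have hdescent : ∀ m (hm : m < M + 1),
      ∃ L, (hypergraph e).IsHyperpath (e.symm source) (e.symm (.inr (.inr ⟨m, hm⟩))) L ∧
        hyperpathLength L ≤ 3 * J + 1 + m := by
    intro m
    induction m with
    | zero =>
      intro hm
      obtain ⟨L, hL, hlen⟩ := hcolumn (J - 1) (by omega)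
      refine ⟨_, hL.append (isHyperpath_fullEdge (by simp)
        (reaches_column_descent_zero (by omega))), ?_⟩
      rw [hyperpathLength_append, hyperpathLength_singleton]
      have : (fullEdge e (.inr (.inl ⟨J - 1, by omega⟩))).dest.card ≤ J + 1 := by
        -- The whole column is counted, including the transmitting vertex; the slack of one does no
        -- harm.
        refine (card_fullEdge_dest_le (insert (.inr (.inr ⟨0, hm⟩))
          (Finset.univ.map (Function.Embedding.inl.trans Function.Embedding.inr))) ?_).trans
          ((Finset.card_insert_le _ _).trans (by simp))
        rintro (i | j' | m) hne h
        · exact absurd h not_reaches_column_chain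
        · simp
        · have := (reaches_column_descent h).2
          simp [Fin.ext_iff, this]
      omega
    | succ m ih =>
      intro hm
      obtain ⟨L, hL, hlen⟩ := ih (by omega)
      refine ⟨_, hL.append (isHyperpath_fullEdge (by simp) (reaches_descent_succ hm)), ?_⟩
      rw [hyperpathLength_append, hyperpathLength_singleton]
      have : (fullEdge e (.inr (.inr ⟨m, by omega⟩))).dest.card ≤ 1 := by
        refine (card_fullEdge_dest_le {.inr (.inr ⟨m + 1, hm⟩)} ?_).trans
          (Finset.card_singleton _).le
        rintro (i | j' | m') hne h
        · exact absurd h not_reaches_descent_chain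
        · exact absurd h not_reaches_descent_column
        · have := reaches_descent_descent (fun h0 => hne (by rw [h0])) h
          simp [Fin.ext_iff, this]
      omega
  exact hdescent M (by omega)

end Bounds

/-- The target can be entered only from the last chain point, which has the same potential, or from
the descent point just above, which `hsrc` excludes. The chain itself can be entered only from the
chain, and a step from i to i + 1 covers at least i + 1 points. -/
theorem potential_le_of_mem_edges (hA : Admissible K J M) {f : DirectedHyperedge V}
    (hf : f ∈ (hypergraph e).edges) (hsrc : ∀ m, e f.src = .inr (.inr m) → (m : ℕ) + 1 ≠ M)
    {u : V} (hu : u ∈ f.dest) :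
    potential (e u) ≤ potential (e f.src) + f.dest.card := by
  classical
  obtain ⟨hne, hpos, h⟩ := ne_and_reaches hf hu
  have hne' : e u ≠ e f.src := e.injective.ne hne
  rcases hb : e u with j | j | m'
  · rcases ha : e f.src with i | i | m <;> rw [ha, hb] at h
    · have hle := le_succ_of_reaches_chain h
      rcases Nat.lt_or_ge i j with hlt | hge
      · have hj : (j : ℕ) = i + 1 := by omega
        have hi : (i : ℕ) + 1 < K + 1 := by omega
        have hcard : (i : ℕ) + 1 ≤ f.dest.card := by
          have hsub : ((Finset.Iic (⟨i + 1, hi⟩ : Fin (K + 1))).erase i).map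
              (Function.Embedding.inl.trans e.symm.toEmbedding) ⊆ f.dest := by
            intro v hv
            obtain ⟨k, hk, rfl⟩ := Finset.mem_map.1 hv
            simp only [Finset.mem_erase, Finset.mem_Iic] at hk
            refine mem_dest_of_sqDist_le hf hu ?_ ?_
            · intro h0
              apply hk.1
              rw [← h0] at ha
              simpa using ha
            · rw [ha, hb]
              have hjj : j = ⟨i + 1, hi⟩ := Fin.ext hj
              rw [hjj]
              simpa using sqDist_chain_le (J := J) (M := M) hi hk.2
          have := Finset.card_le_card hsub
          rw [Finset.card_map, Finset.card_erase_of_mem, Fin.card_Iic] at this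
          · simpa using this
          · simp [Finset.mem_Iic, Fin.le_def]
        simp only [potential, hj]
        rw [Nat.choose_succ_succ' (i + 1) 1, Nat.choose_one_right]
        change _ + ((i : ℕ) + 1).choose 2 ≤ _
        omega
      · simp only [potential]
        exact (Nat.choose_le_choose 2 (Nat.succ_le_succ hge)).trans (Nat.le_add_right _ _)
    · exact absurd h not_reaches_column_chain
    · exact absurd h not_reaches_descent_chain
  · simp [potential]
  · by_cases hm' : (m' : ℕ) = M
    · rcases ha : e f.src with i | i | m <;> rw [ha, hb] at h
      · have := (reaches_chain_descent hA.two_le hA.lt_pow h).1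
        simp [potential, hm', this]
      · have := (reaches_column_descent h).2
        have := hA.succ_le
        omega
      · have := reaches_descent_descent (fun h0 => hne' (by rw [ha, hb, h0])) h
        exact absurd (this.symm.trans hm') (hsrc m ha)
    · simp [potential, hm']

/-- A hyperpath that is shorter than the chain allows covers the whole descent. -/
theorem le_hyperpathWidth [Fintype V] (hA : Admissible K J M) {L : List (DirectedHyperedge V)}
    (hL : (hypergraph e).IsHyperpath (e.symm source) (e.symm target) L)
    (hlen : hyperpathLength L < (K + 1).choose 2) : M ≤ hyperpathWidth L := by
  classical
  -- Otherwise the potential of the target forces length at least C(K+1,2).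
  have hex : ∃ f ∈ L, ∃ m, e f.src = .inr (.inr m) ∧ (m : ℕ) + 1 = M := by
    by_contra! hno
    have := hL.potential_le (fun v => potential (e v)) fun f hf u hu =>
      potential_le_of_mem_edges hA (hL.1 f hf) (hno f hf) hu
    simp [potential, source, target] at this
    omega
  -- Induction up the descent: a descent point strictly between top and target is reached only from
  -- the one just above it.
  have hall : ∀ k m (hm : m < M), m + 1 + k = M →
      ∃ f ∈ L, e f.src = .inr (.inr ⟨m, by omega⟩) := by
    intro k
    induction k with
    | zero =>
      intro m hm hmk
      obtain ⟨f, hf, m', hm', hmM⟩ := hex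
      have hmm : m' = ⟨m, by omega⟩ := Fin.ext (by simp only; omega)
      exact ⟨f, hf, hm'.trans (congrArg (fun k => Sum.inr (Sum.inr k)) hmm)⟩
    | succ k ih =>
      intro m hm hmk
      obtain ⟨f, hf, hfm⟩ := ih (m + 1) (by omega) (by omega)
      rcases hL.src_eq_or_exists hf with h | ⟨g, hg, hgm⟩
      · rw [h] at hfm
        simp [source] at hfm
      · refine ⟨g, hg, ?_⟩
        obtain ⟨hne, -, h⟩ := ne_and_reaches (hL.1 g hg) hgm
        have hne' := e.injective.ne hne
        rw [hfm] at h hne'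
        rcases ha : e g.src with i | i | m' <;> rw [ha] at h hne'
        · have := (reaches_chain_descent hA.two_le hA.lt_pow h).2
          simp only at this
          omega
        · have := (reaches_column_descent h).2
          simp at this
        · have := reaches_descent_descent (fun h0 => hne' (by rw [h0])) h
          congr 2
          exact Fin.ext (by simp only at this ⊢; omega)
  have hcover : ∀ m (hm : m < M), e.symm (.inr (.inr ⟨m, by omega⟩)) ∈ hyperpathCover L := by
    intro m hm
    obtain ⟨f, hf, hfm⟩ := hall (M - 1 - m) m hm (by omega)
    rw [← hfm, e.symm_apply_apply]
    rcases hL.src_eq_or_exists hf with h | h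
    · rw [h]
      exact hL.mem_cover_source
    · exact Or.inl h
  have hinj : Function.Injective fun m : Fin M =>
      e.symm (.inr (.inr (Fin.castSucc m)) : TightVertex K J M) := by
    intro a b hab
    simpa using hab
  rw [hyperpathWidth]
  calc M = (Set.range fun m : Fin M =>
      e.symm (.inr (.inr (Fin.castSucc m)) : TightVertex K J M)).ncard := by
        rw [Set.ncard_range_of_injective hinj, Nat.card_fin]
    _ ≤ _ := Set.ncard_le_ncard (by rintro _ ⟨m, rfl⟩; exact hcover m m.2) (Set.toFinite _)

end TightVertex

/-! ### Tight example: choice of parameters and asymptotics. -/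

open DirectedHypergraph

/-- Take the largest J with (3/2)^J ≤ 2^(K+1): maximality gives (3/2)^J > (4/3) 2^K, and (3/2)² > 2
gives the bound on J. -/
theorem exists_three_halves_pow (K : ℕ) :
    ∃ J : ℕ, (2 : ℝ) ^ K < (3 / 2) ^ J ∧ (3 / 2 : ℝ) ^ J ≤ 2 ^ (K + 1) ∧ J ≤ 2 * K + 2 := by
  obtain ⟨J, h1, h2⟩ := exists_nat_pow_near (one_le_pow₀ (by norm_num) : (1 : ℝ) ≤ 2 ^ (K + 1))
    (by norm_num : (1 : ℝ) < 3 / 2)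
  refine ⟨J, ?_, h1, ?_⟩
  · rw [pow_succ, pow_succ] at h2
    have : (0 : ℝ) < 2 ^ K := by positivity
    linarith
  · by_contra! hlt
    have h3 : (3 / 2 : ℝ) ^ (2 * (K + 1)) < (3 / 2) ^ J :=
      pow_lt_pow_right₀ (by norm_num) (by omega)
    have h4 : (2 : ℝ) ^ (K + 1) ≤ (3 / 2) ^ (2 * (K + 1)) := by
      rw [pow_mul]
      exact pow_le_pow_left₀ (by norm_num) (by norm_num) _
    linarith

/-- Disk hypergraphs on which a shortest path is wider than a thinnest path by a factor of
almost `√(n / 2)`. -/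
theorem exists_wide_shortestPath {n K : ℕ} (hK : 2 ≤ K) (hn : 4 * K + 5 ≤ n)
    (hnK : n + 3 * K + 3 < (K + 1).choose 2) :
    ∃ (p : Fin n → EuclideanSpace ℝ (Fin 2)) (R : Fin n → ℝ) (s t : Fin n),
      Function.Injective p ∧ (∀ v, 0 ≤ R v) ∧ s ≠ t ∧
      (∃ L, (diskHypergraph p R).IsShortestPath s t L) ∧
      ∀ L Lopt, (diskHypergraph p R).IsShortestPath s t L →
        (diskHypergraph p R).IsThinnestPath s t Lopt →
        hyperpathWidth Lopt ≤ K + 3 ∧ n ≤ hyperpathWidth L + 3 * K + 4 := by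
  obtain ⟨J, hJ1, hJ2, hJ3⟩ := exists_three_halves_pow K
  obtain ⟨M, rfl⟩ : ∃ M, n = K + 1 + (J + (M + 1)) := ⟨n - (K + J + 2), by omega⟩
  have hA : TightVertex.Admissible K J M := ⟨hK, hJ1, hJ2, by omega⟩
  have e : Fin (K + 1 + (J + (M + 1))) ≃ TightVertex K J M :=
    (Fintype.equivFinOfCardEq (by simp)).symm
  obtain ⟨L₁, hL₁, hw₁⟩ := TightVertex.exists_thin_hyperpath (e := e) hA
  obtain ⟨L₂, hL₂, hl₂⟩ := TightVertex.exists_short_hyperpath (e := e) hA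
  refine ⟨fun v => TightVertex.point (e v), fun v => TightVertex.range (e v),
    e.symm TightVertex.source, e.symm TightVertex.target,
    TightVertex.point_injective.comp e.injective, fun v => TightVertex.range_nonneg _,
    e.symm.injective.ne (by simp [TightVertex.source, TightVertex.target]),
    exists_isShortestPath ⟨L₁, hL₁⟩, fun L Lopt hL hopt => ⟨(hopt.2 _ hL₁).trans hw₁, ?_⟩⟩
  have h1 := hL.2 _ hL₂
  -- As J ≤ 2K + 2, the short path has length at most 3J + 1 + M ≤ n + 3K + 3; likewise M ≥ n - 3K -
  -- 4.
  have h2 := TightVertex.le_hyperpathWidth hA hL.1 (by omega)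
  omega

theorem lt_choose_two_of_lt_sq {n r : ℕ} (h : 2 * n < (r + 1) ^ 2) :
    n + 3 * (r + 10) + 3 < (r + 10 + 1).choose 2 := by
  have h1 : (r + 10 + 1).choose 2 * 2 = (r + 10 + 1) * (r + 10) := by
    rw [Nat.choose_two_right, Nat.add_sub_cancel, Nat.div_mul_cancel]
    exact (Nat.even_mul_pred_self (r + 10 + 1)).two_dvd
  linarith

theorem eventually_exists_wide_shortestPath (ε : ℝ) (hε : 0 < ε) :
    ∀ᶠ n : ℕ in Filter.atTop,
      ∃ (p : Fin n → EuclideanSpace ℝ (Fin 2)) (R : Fin n → ℝ) (s t : Fin n),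
        Function.Injective p ∧ (∀ v, 0 ≤ R v) ∧ s ≠ t ∧
        (∃ L, (diskHypergraph p R).IsShortestPath s t L) ∧
        ∀ L Lopt, (diskHypergraph p R).IsShortestPath s t L →
          (diskHypergraph p R).IsThinnestPath s t Lopt →
          (1 - ε) * Real.sqrt ((n : ℝ) / 2) * (hyperpathWidth Lopt : ℝ) ≤
            (hyperpathWidth L : ℝ) := by
  have hlarge : ∀ᶠ n : ℕ in Filter.atTop, (10000 : ℝ) ≤ n ∧ (60 / ε) ^ 2 ≤ n :=
    (tendsto_natCast_atTop_atTop.eventually_ge_atTop _).and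
      (tendsto_natCast_atTop_atTop.eventually_ge_atTop _)
  filter_upwards [hlarge] with n ⟨hn1, hn2⟩
  -- K²/2 must just exceed n; the shift by 10 leaves room for the linear terms in K.
  obtain ⟨K, hKdef⟩ : ∃ K, K = Nat.sqrt (2 * n) + 10 := ⟨_, rfl⟩
  set x := Real.sqrt ((n : ℝ) / 2) with hx
  have hx0 : 0 ≤ x := Real.sqrt_nonneg _
  have hxx : x * x = n / 2 := Real.mul_self_sqrt (by positivity)
  have hx70 : 70 ≤ x := by
    apply Real.le_sqrt_of_sq_le
    linarith
  have hKx : (K : ℝ) ≤ 2 * x + 10 := by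
    have h1 : Real.sqrt ((2 * n : ℕ) : ℝ) = 2 * x := by
      rw [show (((2 * n : ℕ) : ℝ)) = 2 ^ 2 * (n / 2) by push_cast; ring,
        Real.sqrt_mul (by norm_num), Real.sqrt_sq (by norm_num)]
    have h2 := Real.nat_sqrt_le_real_sqrt (a := 2 * n)
    rw [h1] at h2
    rw [hKdef]
    push_cast
    linarith
  have hn : 4 * K + 5 ≤ n := by
    have : (4 * K + 5 : ℝ) ≤ n := by nlinarith
    exact_mod_cast this
  have hnK : n + 3 * K + 3 < (K + 1).choose 2 := by
    rw [hKdef]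
    exact lt_choose_two_of_lt_sq (Nat.sqrt_lt'.1 (Nat.lt_succ_self (Nat.sqrt (2 * n))))
  obtain ⟨p, R, s, t, hp, hR, hst, hex, hmain⟩ :=
    exists_wide_shortestPath (by omega : 2 ≤ K) hn hnK
  refine ⟨p, R, s, t, hp, hR, hst, hex, fun L Lopt hL hopt => ?_⟩
  obtain ⟨h1, h2⟩ := hmain L Lopt hL hopt
  have h1' : (hyperpathWidth Lopt : ℝ) ≤ K + 3 := by exact_mod_cast h1
  have h2' : (n : ℝ) ≤ hyperpathWidth L + 3 * K + 4 := by exact_mod_cast h2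
  rcases le_total 1 ε with hε1 | hε1
  · refine le_trans ?_ (Nat.cast_nonneg _)
    exact mul_nonpos_of_nonpos_of_nonneg
      (mul_nonpos_of_nonpos_of_nonneg (by linarith) hx0) (Nat.cast_nonneg _)
  · have hεx : 20 ≤ ε * x := by
      have h3 : 60 / ε / 2 ≤ x := by
        apply Real.le_sqrt_of_sq_le
        linarith [show (60 / ε / 2) ^ 2 = (60 / ε) ^ 2 / 4 by ring, sq_nonneg (60 / ε)]
      rw [div_div, div_le_iff₀ (by positivity)] at h3
      linarith
    calc (1 - ε) * x * (hyperpathWidth Lopt : ℝ) ≤ (1 - ε) * x * (2 * x + 13) := by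
          apply mul_le_mul_of_nonneg_left (by linarith)
          exact mul_nonneg (by linarith) hx0
      -- Since 2x² = n, the claim reduces to 19x + 34 ≤ εx(2x + 13), which follows from εx ≥ 20.
      _ ≤ (n : ℝ) - 3 * K - 4 := by nlinarith
      _ ≤ hyperpathWidth L := by linarith

theorem theorem7 :
    -- general directed hypergraphs
    (∀ (V : Type*) [Fintype V] (H : DirectedHypergraph V),
      H.ShortestPathApprox (Real.sqrt ((Fintype.card V : ℝ) / 2))) ∧
    -- ring hypergraphs in `d`-dimensional Euclidean space
    (∀ (V : Type*) [Fintype V] (d : ℕ) (p : V → EuclideanSpace ℝ (Fin d)) (r R : V → ℝ),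
      Function.Injective p → (∀ v, 0 ≤ r v ∧ r v ≤ R v) →
      (ringHypergraph p r R).ShortestPathApprox (2 * (1 + 2 * ringRatio p r R) ^ d) ∧
      (closedRingHypergraph p r R).ShortestPathApprox (2 * (1 + 2 * ringRatio p r R) ^ d)) ∧
    -- asymptotic tightness of the first ratio, in the plane
    (∀ ε : ℝ, 0 < ε → ∀ᶠ n : ℕ in Filter.atTop,
      ∃ (p : Fin n → EuclideanSpace ℝ (Fin 2)) (R : Fin n → ℝ) (s t : Fin n),
        Function.Injective p ∧ (∀ v, 0 ≤ R v) ∧ s ≠ t ∧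
        (∃ L, (diskHypergraph p R).IsShortestPath s t L) ∧
        ∀ L Lopt, (diskHypergraph p R).IsShortestPath s t L →
          (diskHypergraph p R).IsThinnestPath s t Lopt →
          (1 - ε) * Real.sqrt ((n : ℝ) / 2) * (hyperpathWidth Lopt : ℝ) ≤
            (hyperpathWidth L : ℝ)) := by
  refine ⟨fun V _ H => shortestPathApprox_sqrt_half_card H, fun V _ d p r R hp hrR => ⟨?_, ?_⟩,
    eventually_exists_wide_shortestPath⟩
  · exact ballHypergraph_shortestPathApprox p r R _ hp hrR fun v => Set.Ioc_subset_Icc_self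
  · exact ballHypergraph_shortestPathApprox p r R _ hp hrR fun v => subset_rfl
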